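/- Let $(u,v,x,y)$ be the coordinates of $\mathbb{R}^4$, and let $g$ be the plane wave metric $$g = H\,du\otimes du + du\otimes dv + dv\otimes du + dx\otimes dx + dy\otimes dy,\qquad H = -x^2-y^2,$$ which is Lorentzian of signature $(-,+,+,+)$. With $k=-y$ and $h=x$, let $$Z = \tfrac12\,(H+k^2+h^2)\,\partial_v - \partial_u + k\,\partial_x + h\,\partial_y,$$ let $\nabla u$ be the $g$-gradient of $u$, and put $X = k\,\partial_v+\partial_x$, $Y = h\,\partial_v+\partial_y$. Orient $\mathbb{R}^4$ so that $(\partial_v,\partial_u,\partial_x,\partial_y)$ is positive (equivalently, so that $(Z,\nabla u,X,Y)$ is positive). *Definitions.* For vector fields $K,T$ on an oriented semi-Riemannian $4$-manifold $(M,g)$ put $\mathcal V=\mathrm{span}(K,T)$ and $\mathcal H=\mathcal V^{\perp}$, and suppose that $K,T$ are everywhere linearly independent and that $g|_{\mathcal H}$ is positive definite. Then $J_{g,K,T}$ is the almost complex structure with $JK=T$, $JT=-K$, which on $\mathcal H$ is the $g$-isometry with square $-1$ that respects the orientation of $\mathcal H$, i.e. $(K,T,a,Ja)$ is positively oriented for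 $0\neq a\in\mathcal H$. For a vector field $W$ in $\mathcal V$, the shear $\nabla^oW$ is the trace-free symmetric part of the endomorphism $\pi\circ\nabla W|_{\mathcal H}$ of $\mathcal H$, where $\nabla$ is the Levi-Civita connection and $\pi$ is the orthogonal projection onto $\mathcal H$. The manifold $(M,g,K,T)$ is *admissible* if, besides the above, $[K,\Gamma(\mathcal H)]\subset\Gamma(\mathcal H)$, $[T,\Gamma(\mathcal H)]\subset\Gamma(\mathcal H)$ and $J\nabla^oK=\nabla^o(JK)$ on $\mathcal H$; $T=\ell\,\nabla\tau$ for some smooth functions $\ell,\tau$; and the gradients of $g(K,T)$ and $g(K,K)$ lie in $\mathcal V$. *Claim.* The field $Z$ is null (nowhere zero, with $g(Z,Z)=0$), $(\mathbb{R}^4,g,Z,\nabla u)$ is admissible, and $J:=J_{g,Z,\nabla u}$ satisfies $JX=Y$. Moreover, with $Z^\flat=g(Z,\cdot)$, the tensor $$g_K := d\big(e^{u}Z^\flat\big)(\cdot,J\cdot)$$ is a Kähler metric with respect to $J$ on all of $\mathbb{R}^4$: $J$ is an integrable almost complex structure (its Nijenhuis tensor vanishes), $g_K$ is a $J$-invariant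 Riemannian metric, and its Kähler form $g_K(J\cdot,\cdot)$ is closed. -/

import Mathlib

open scoped ContDiff Matrix

noncomputable section

namespace PlaneWave

/-! ## Semi-Riemannian geometry on `ℝ⁴`, in its global chart -/

/-- `ℝ⁴`, as a smooth manifold with its global chart; all its tangent spaces are `ℝ⁴`. -/
abbrev R4 : Type := Fin 4 → ℝ

/-- Vector fields on `ℝ⁴`. -/
abbrev VF : Type := R4 → R4

/-- Fields of bilinear forms on `ℝ⁴`. -/
abbrev BilinField : Type := R4 → R4 →L[ℝ] R4 →L[ℝ] ℝ

/-- Fields of endomorphisms of the tangent spaces of `ℝ⁴`. -/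
abbrev EndField : Type := R4 → R4 →L[ℝ] R4

/-- The `i`-th coordinate vector. -/
def e (i : Fin 4) : R4 := Pi.single i 1

/-- A semi-Riemannian metric: smooth, symmetric and nondegenerate. (Its signature is then constant,
as `ℝ⁴` is connected.) -/
structure IsSemiRiemannian (g : BilinField) : Prop where
  smooth : ContDiff ℝ ∞ g
  symm : ∀ p v w, g p v w = g p w v
  nondeg : ∀ p v, (∀ w, g p v w = 0) → v = 0

/-- A Lorentzian metric, of signature `(- + + +)`: every tangent space has a timelike vector whose
orthogonal complement is positive definite. -/
structure IsLorentzian (g : BilinField) : Prop extends IsSemiRiemannian g where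
  signature : ∀ p, ∃ t, g p t t < 0 ∧ ∀ v, g p t v = 0 → v ≠ 0 → 0 < g p v v

/-- A null vector field: nowhere vanishing, of zero length. -/
def IsNull (g : BilinField) (X : VF) : Prop := ∀ p, X p ≠ 0 ∧ g p (X p) (X p) = 0

/-- The Gram matrix `(g_ij)` in the coordinate frame. -/
def gram (g : BilinField) (p : R4) : Matrix (Fin 4) (Fin 4) ℝ :=
  Matrix.of fun i j => g p (e i) (e j)

/-- Raising an index: the vector `v` with `g(v, ·) = α` for a linear form `α` at `p`,
that is `v^i = g^{ij} α_j`. -/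
def sharp (g : BilinField) (p : R4) (α : R4 → ℝ) : R4 := (gram g p)⁻¹ *ᵥ fun j => α (e j)

/-- The gradient: `g(∇φ, ·) = dφ`. -/
def grad (g : BilinField) (φ : R4 → ℝ) : VF := fun p => sharp g p (fderiv ℝ φ p)

/-- The Christoffel symbols `Γ(v, w) = Γ^k_{ij} v^i w^j` of the Levi-Civita connection:
`2 g(Γ(v, w), z) = (∂_v g)(w, z) + (∂_w g)(v, z) - (∂_z g)(v, w)`. -/
def christoffel (g : BilinField) (p v w : R4) : R4 :=
  sharp g p fun z =>
    (1 / 2 : ℝ) * (fderiv ℝ g p v w z + fderiv ℝ g p w v z - fderiv ℝ g p z v w)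

/-- The Levi-Civita covariant derivative `∇_v X` at `p`. -/
def nabla (g : BilinField) (X : VF) (p v : R4) : R4 :=
  fderiv ℝ X p v + christoffel g p v (X p)

/-! ## The splitting `V ⊕ H` and relative shear -/

/-- `V = span (K, T)`. -/
def vert (K T : VF) (p : R4) : Submodule ℝ R4 := Submodule.span ℝ {K p, T p}

/-- `H = V^⊥`. -/
def horiz (g : BilinField) (K T : VF) (p : R4) : Set R4 := {v | ∀ w ∈ vert K T p, g p w v = 0}

/-- The matrix of `g` on the pair `K, T`. -/
def gram2 (g : BilinField) (K T : VF) (p : R4) : Matrix (Fin 2) (Fin 2) ℝ :=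
  !![g p (K p) (K p), g p (K p) (T p); g p (T p) (K p), g p (T p) (T p)]

/-- The coefficients in the basis `K, T` of the `V`-component of `v`. -/
def vertCoeff (g : BilinField) (K T : VF) (p v : R4) : Fin 2 → ℝ :=
  (gram2 g K T p)⁻¹ *ᵥ ![g p (K p) v, g p (T p) v]

/-- The projection `π` onto `H` along `V`. -/
def proj (g : BilinField) (K T : VF) (p v : R4) : R4 :=
  v - (vertCoeff g K T p v 0 • K p + vertCoeff g K T p v 1 • T p)

/-- The trace of the endomorphism `π ∘ ∇X` of `H`, computed as the trace on `ℝ⁴` of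
`π ∘ ∇X ∘ π`, which extends it by zero on `V`. -/
def expansion (g : BilinField) (K T X : VF) (p : R4) : ℝ :=
  Matrix.trace (Matrix.of fun i j => proj g K T p (nabla g X p (proj g K T p (e j))) i)

/-- The relative shear operator of `X`: the trace-free symmetric part of the endomorphism `π ∘ ∇X`
of the (rank two) distribution `H`, extended by zero on `V`. Namely, for `a, b` in `H`,
`g(shear a, b) = (g(∇_a X, b) + g(∇_b X, a)) / 2 - (tr_H (π ∘ ∇X) / 2) g(a, b)`. -/
def shear (g : BilinField) (K T X : VF) (p a : R4) : R4 :=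
  sharp g p fun b =>
    (1 / 2 : ℝ) * (g p (nabla g X p (proj g K T p a)) (proj g K T p b)
        + g p (nabla g X p (proj g K T p b)) (proj g K T p a))
      - (1 / 2 : ℝ) * expansion g K T X p * g p (proj g K T p a) (proj g K T p b)

/-! ## Admissible almost complex structures -/

/-- The ordered quadruple `v` is a positively oriented basis. -/
def IsPositiveFrame (o : Orientation ℝ R4 (Fin 4)) (v : Fin 4 → R4) : Prop :=
  ∃ b : Module.Basis (Fin 4) ℝ R4, ⇑b = v ∧ b.orientation = o

/-- `L` is the value at `p` of the almost complex structure `J_{g,K,T}`: it sends `K` to `T` and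
`T` to `-K`, and on `H` it is the isometry with square `-1` respecting the orientation of `H`, i.e.
the one for which the orientations of `V` (given by `K, T`) and `H` add up to that of `ℝ⁴`. -/
structure IsAdmissibleJAt (g : BilinField) (o : Orientation ℝ R4 (Fin 4)) (K T : VF) (p : R4)
    (L : R4 →L[ℝ] R4) : Prop where
  map_fst : L (K p) = T p
  map_snd : L (T p) = -K p
  map_horiz : ∀ a ∈ horiz g K T p, L a ∈ horiz g K T p
  sq_horiz : ∀ a ∈ horiz g K T p, L (L a) = -a
  isometry_horiz : ∀ a ∈ horiz g K T p, ∀ b ∈ horiz g K T p, g p (L a) (L b) = g p a b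
  orient_horiz : ∀ a ∈ horiz g K T p, a ≠ 0 → IsPositiveFrame o ![K p, T p, a, L a]

open Classical in
/-- The almost complex structure `J_{g,K,T}`. At a point where `K, T` are independent and `H` is a
spacelike plane, the endomorphism described above is unique; the value is zero where there is none. -/
def admissibleJ (g : BilinField) (o : Orientation ℝ R4 (Fin 4)) (K T : VF) : EndField :=
  fun p => if h : ∃ L, IsAdmissibleJAt g o K T p L then h.choose else 0

/-- `J_{g,K,T}` is an admissible almost complex structure. -/
structure IsAdmissibleAlmostComplex (g : BilinField) (o : Orientation ℝ R4 (Fin 4)) (K T : VF) :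
    Prop where
  semiRiemannian : IsSemiRiemannian g
  smooth_fst : ContDiff ℝ ∞ K
  smooth_snd : ContDiff ℝ ∞ T
  linearIndependent : ∀ p, LinearIndependent ℝ ![K p, T p]
  spacelike : ∀ p, ∀ a ∈ horiz g K T p, a ≠ 0 → 0 < g p a a
  isAdmissibleJAt : ∀ p, IsAdmissibleJAt g o K T p (admissibleJ g o K T p)

/-- `J_{g,K,T}` is an admissible complex structure: in addition `[K, Γ(H)] ⊆ Γ(H)`,
`[T, Γ(H)] ⊆ Γ(H)`, and `J ∘ shear K = shear (J K)` on `H`. -/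
structure IsAdmissibleComplex (g : BilinField) (o : Orientation ℝ R4 (Fin 4)) (K T : VF) : Prop
    extends IsAdmissibleAlmostComplex g o K T where
  bracket_fst : ∀ W : VF, ContDiff ℝ ∞ W → (∀ p, W p ∈ horiz g K T p) →
    ∀ p, VectorField.lieBracket ℝ K W p ∈ horiz g K T p
  bracket_snd : ∀ W : VF, ContDiff ℝ ∞ W → (∀ p, W p ∈ horiz g K T p) →
    ∀ p, VectorField.lieBracket ℝ T W p ∈ horiz g K T p
  shear_comm : ∀ p, ∀ a ∈ horiz g K T p,
    admissibleJ g o K T p (shear g K T K p a) =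
      shear g K T (fun q => admissibleJ g o K T q (K q)) p a

/-- `(ℝ⁴, g, K, T)` is admissible. -/
structure IsAdmissible (g : BilinField) (o : Orientation ℝ R4 (Fin 4)) (K T : VF) : Prop where
  complex : IsAdmissibleComplex g o K T
  exists_grad : ∃ τ l : R4 → ℝ, ContDiff ℝ ∞ τ ∧ ContDiff ℝ ∞ l ∧ ∀ p, T p = l p • grad g τ p
  grad_fst_snd : ∀ p, grad g (fun q => g q (K q) (T q)) p ∈ vert K T p
  grad_fst_fst : ∀ p, grad g (fun q => g q (K q) (K q)) p ∈ vert K T p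

/-! ## Kähler metrics -/

/-- The Nijenhuis tensor `[JA, JB] - J[JA, B] - J[A, JB] - [A, B]`. -/
def nijenhuis (J : EndField) (A B : VF) (p : R4) : R4 :=
  VectorField.lieBracket ℝ (fun q => J q (A q)) (fun q => J q (B q)) p
    - J p (VectorField.lieBracket ℝ (fun q => J q (A q)) B p)
    - J p (VectorField.lieBracket ℝ A (fun q => J q (B q)) p)
    - VectorField.lieBracket ℝ A B p

/-- `h` is a Kähler metric on `ℝ⁴` with respect to `J`: `J` is an integrable almost complex
structure, `h` is a `J`-invariant Riemannian metric, and the Kähler form `h(J·, ·)` is closed. -/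
structure IsKahler (J : EndField) (h : BilinField) : Prop where
  smooth_J : ContDiff ℝ ∞ J
  sq_J : ∀ p a, J p (J p a) = -a
  integrable : ∀ A B : VF, ContDiff ℝ ∞ A → ContDiff ℝ ∞ B → ∀ p, nijenhuis J A B p = 0
  smooth : ContDiff ℝ ∞ h
  symm : ∀ p a b, h p a b = h p b a
  pos : ∀ p a, a ≠ 0 → 0 < h p a a
  hermitian : ∀ p a b, h p (J p a) (J p b) = h p a b
  closed : ∃ Ω : R4 → R4 [⋀^Fin 2]→L[ℝ] ℝ, ContDiff ℝ ∞ Ω ∧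
    (∀ p a b, Ω p ![a, b] = h p (J p a) b) ∧ ∀ p, extDeriv Ω p = 0

/-- The `2`-form `d(f(τ) K^♭)`, where `K^♭ = g(K, ·)`. -/
def dFlat (g : BilinField) (K : VF) (f : ℝ → ℝ) (τ : R4 → ℝ) : R4 → R4 [⋀^Fin 2]→L[ℝ] ℝ :=
  extDeriv fun p => f (τ p) • ContinuousAlternatingMap.ofSubsingleton ℝ R4 ℝ (0 : Fin 1) (g p (K p))

/-- A `2`-form as a bilinear form. -/
def toBilin (η : R4 [⋀^Fin 2]→L[ℝ] ℝ) : R4 →L[ℝ] R4 →L[ℝ] ℝ :=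
  ((ContinuousAlternatingMap.ofSubsingletonLIE (𝕜 := ℝ) (E := R4) (F := ℝ) (ι := Fin 1)
      0).symm.toContinuousLinearEquiv : (R4 [⋀^Fin 1]→L[ℝ] ℝ) →L[ℝ] (R4 →L[ℝ] ℝ)).comp η.curryLeft

theorem toBilin_apply (η : R4 [⋀^Fin 2]→L[ℝ] ℝ) (a b : R4) : toBilin η a b = η ![a, b] := by
  change η (Matrix.vecCons a fun _ => b) = _
  congr 1
  ext i
  fin_cases i <;> rfl

/-- The tensor `d(f(τ) K^♭)(·, J·)`, with `J = J_{g,K,T}`. -/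
def inducedTensor (g : BilinField) (o : Orientation ℝ R4 (Fin 4)) (K T : VF) (f : ℝ → ℝ)
    (τ : R4 → ℝ) : BilinField := fun p =>
  (toBilin (dFlat g K f τ p)).bilinearComp (ContinuousLinearMap.id ℝ R4) (admissibleJ g o K T p)

theorem inducedTensor_apply (g : BilinField) (o : Orientation ℝ R4 (Fin 4)) (K T : VF) (f : ℝ → ℝ)
    (τ : R4 → ℝ) (p a b : R4) :
    inducedTensor g o K T f τ p a b = dFlat g K f τ p ![a, admissibleJ g o K T p b] := by
  simp [inducedTensor, toBilin_apply]

/-! ## Standard pp-waves, in coordinates `(u, v, x, y)` -/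

/-- The coordinate function `u`. -/
def uCoord (p : R4) : ℝ := p 0

/-- The tensor product of two linear forms. -/
def tmul (α β : R4 →L[ℝ] ℝ) : R4 →L[ℝ] R4 →L[ℝ] ℝ := α.smulRight β

/-- The coordinate differentials `du, dv, dx, dy`. -/
def dc (i : Fin 4) : R4 →L[ℝ] ℝ := ContinuousLinearMap.proj i

/-- The metric `H(u,x,y) du ⊗ du + du ⊗ dv + dv ⊗ du + dx ⊗ dx + dy ⊗ dy`. -/
def ppWave (H : ℝ → ℝ → ℝ → ℝ) : BilinField := fun p =>
  H (p 0) (p 2) (p 3) • tmul (dc 0) (dc 0) + tmul (dc 0) (dc 1) + tmul (dc 1) (dc 0)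
    + tmul (dc 2) (dc 2) + tmul (dc 3) (dc 3)

/-- The null field `Z = ½ (H + k² + h²) ∂_v - ∂_u + k ∂_x + h ∂_y`. -/
def nullField (H k h : ℝ → ℝ → ℝ → ℝ) : VF := fun p =>
  ((1 / 2 : ℝ) * (H (p 0) (p 2) (p 3) + k (p 0) (p 2) (p 3) ^ 2 + h (p 0) (p 2) (p 3) ^ 2)) • e 1
    - e 0 + k (p 0) (p 2) (p 3) • e 2 + h (p 0) (p 2) (p 3) • e 3

/-- The field `k ∂_v + ∂_x`. -/
def xField (k : ℝ → ℝ → ℝ → ℝ) : VF := fun p => k (p 0) (p 2) (p 3) • e 1 + e 2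

/-- The field `h ∂_v + ∂_y`. -/
def yField (h : ℝ → ℝ → ℝ → ℝ) : VF := fun p => h (p 0) (p 2) (p 3) • e 1 + e 3

/-- The orientation of `ℝ⁴` for which the ordered frame `∂_v, ∂_u, ∂_x, ∂_y` is positive: the
opposite of that of the coordinates `(u, v, x, y)`. -/
def ppOrientation : Orientation ℝ R4 (Fin 4) := -(Pi.basisFun ℝ (Fin 4)).orientation

end PlaneWave

end

/-! Since H + k² + h² = 0, Z = -∂_u - y∂_x + x∂_y, while N = ∇u = ∂_v. Z and N are null with g(Z, N)
= -1, and X, Y form an orthonormal frame of their complement, so everything becomes explicit in the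
frame Z, N, X, Y, whose dual coframe is α = -du, β = -Z^♭, ξ = dx - y du, η = dy + x du. The
conditions on `admissibleJ` force Z ↦ N ↦ -Z and X ↦ Y ↦ -X (`IsAdmissibleJAt.eq_waveJ`), so the
chosen J is the polynomial field `waveJ`.

Admissibility: N is parallel and ∇Z acts on H as a rotation, so both shears vanish. The two brackets
preserve H by differentiation of its defining equations, and g(Z, N), g(Z, Z) are constant.

Kähler: dZ^♭ = 2 ξ∧η, hence d(e^u Z^♭) = e^u (α∧β + 2 ξ∧η). Composing the second slot with J gives
e^u (α² + β² + 2ξ² + 2η²) (`dFlat_waveJ`), visibly positive and J-invariant. Its Kähler form is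
d(e^u Z^♭) itself, which is exact. Integrability reduces to a polynomial identity in J and its first
derivatives (`nijenhuis_waveJ`). -/

noncomputable section

namespace PlaneWave

/-! ## The derivative along a line -/

/-- The Fréchet derivative in a direction is the derivative along the line in that direction. -/
theorem fderiv_apply_of_hasDerivAt {E F : Type*} [NormedAddCommGroup E] [NormedSpace ℝ E]
    [NormedAddCommGroup F] [NormedSpace ℝ F] {f : E → F} {p v : E} {c : F}
    (hf : DifferentiableAt ℝ f p) (h : HasDerivAt (fun t : ℝ => f (p + t • v)) c 0) :
    fderiv ℝ f p v = c := by
  rw [← hf.lineDeriv_eq_fderiv (v := v)]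
  exact h.deriv

/-- The derivative of a coordinate function along a line. -/
theorem hasDerivAt_coord_line (p v : R4) (i : Fin 4) (t : ℝ) :
    HasDerivAt (fun t : ℝ => (p + t • v) i) (v i) t := by
  simpa using ((hasDerivAt_id t).mul_const (v i)).const_add (p i)

theorem fderiv_pi_apply {f : VF} {p v : R4} (hf : DifferentiableAt ℝ f p) (i : Fin 4) :
    fderiv ℝ f p v i = fderiv ℝ (fun q => f q i) p v := by
  exact congrArg (· v) (hasFDerivAt_pi'.1 hf.hasFDerivAt i).fderiv.symm

/-- Freezing the arguments of a tensor field reduces its derivative to that of explicit functions,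
which are differentiated along lines. -/
theorem fderiv_apply_const {E F : Type*} [NormedAddCommGroup E] [NormedSpace ℝ E]
    [NormedAddCommGroup F] [NormedSpace ℝ F] {L : R4 → E →L[ℝ] F} {p : R4}
    (hL : DifferentiableAt ℝ L p) (v : R4) (w : E) :
    fderiv ℝ (fun q => L q w) p v = fderiv ℝ L p v w := by
  rw [fderiv_clm_apply hL (differentiableAt_const w)]
  simp

/-! ## The metric `-(x² + y²) du² + 2 du dv + dx² + dy²` -/

/-- The plane wave metric with profile `-x² - y²`. -/
def waveMetric : BilinField := ppWave fun _ x y => -x ^ 2 - y ^ 2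

theorem waveMetric_apply (p v w : R4) :
    waveMetric p v w = (-(p 2) ^ 2 - (p 3) ^ 2) * (v 0 * w 0) + v 0 * w 1 + v 1 * w 0
      + v 2 * w 2 + v 3 * w 3 := by
  simp [waveMetric, ppWave, tmul, dc]

theorem e_one : e 1 = ![0, 1, 0, 0] := by
  ext i
  fin_cases i <;> simp [e]

theorem contDiff_coord {n : WithTop ℕ∞} (i : Fin 4) : ContDiff ℝ n fun p : R4 => p i :=
  contDiff_apply ℝ ℝ i

theorem contDiff_waveMetric {n : WithTop ℕ∞} : ContDiff ℝ n waveMetric := by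
  refine contDiff_clm_apply_iff.2 fun v => contDiff_clm_apply_iff.2 fun w => ?_
  simp only [waveMetric_apply]
  fun_prop

theorem fderiv_waveMetric (p a v w : R4) :
    fderiv ℝ waveMetric p a v w = -2 * (p 2 * a 2 + p 3 * a 3) * (v 0 * w 0) := by
  have hd : Differentiable ℝ waveMetric :=
    (contDiff_waveMetric (n := 1)).differentiable one_ne_zero
  rw [← fderiv_apply_const (hd p),
    ← fderiv_apply_const ((hd p).clm_apply (differentiableAt_const v))]
  refine fderiv_apply_of_hasDerivAt
    (((hd p).clm_apply (differentiableAt_const v)).clm_apply (differentiableAt_const w)) ?_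
  simp only [waveMetric_apply]
  have h2 := hasDerivAt_coord_line p a 2 0
  have h3 := hasDerivAt_coord_line p a 3 0
  refine ((((((h2.pow 2).neg.sub (h3.pow 2)).mul_const (v 0 * w 0)).add_const
    (v 0 * w 1)).add_const (v 1 * w 0)).add_const (v 2 * w 2)).add_const (v 3 * w 3)
    |>.congr_deriv ?_
  simp
  ring

theorem gram_waveMetric (p : R4) :
    gram waveMetric p =
      !![-(p 2) ^ 2 - (p 3) ^ 2, 1, 0, 0; 1, 0, 0, 0; 0, 0, 1, 0; 0, 0, 0, 1] := by
  ext i j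
  fin_cases i <;> fin_cases j <;> simp [gram, waveMetric_apply, e]

theorem gram_waveMetric_inv (p : R4) :
    (gram waveMetric p)⁻¹ =
      !![0, 1, 0, 0; 1, (p 2) ^ 2 + (p 3) ^ 2, 0, 0; 0, 0, 1, 0; 0, 0, 0, 1] := by
  refine Matrix.inv_eq_right_inv ?_
  rw [gram_waveMetric]
  ext i j
  fin_cases i <;> fin_cases j <;> simp [Matrix.mul_apply, Fin.sum_univ_four]

theorem sharp_waveMetric (p : R4) (α : R4 → ℝ) :
    sharp waveMetric p α =
      ![α (e 1), α (e 0) + ((p 2) ^ 2 + (p 3) ^ 2) * α (e 1), α (e 2), α (e 3)] := by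
  rw [sharp, gram_waveMetric_inv]
  ext i
  fin_cases i <;> simp [Matrix.mulVec, dotProduct, Fin.sum_univ_four]

theorem sharp_waveMetric_zero (p : R4) : sharp waveMetric p (fun _ => 0) = 0 := by
  rw [sharp_waveMetric]
  ext i
  fin_cases i <;> simp

theorem isLorentzian_waveMetric : IsLorentzian waveMetric where
  smooth := contDiff_waveMetric
  symm p v w := by
    simp only [waveMetric_apply]
    ring
  nondeg p v h := by
    have h0 := h (e 1)
    have h1 := h (e 0)
    have h2 := h (e 2)
    have h3 := h (e 3)
    simp [waveMetric_apply, e] at h0 h1 h2 h3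
    simp [h0] at h1
    ext i
    fin_cases i <;> simp [h0, h1, h2, h3]
  signature p := by
    set r := (p 2) ^ 2 + (p 3) ^ 2 with hr
    -- The second entry is chosen so that g(t, t) = -r + (r - 1) = -1.
    refine ⟨![1, (r - 1) / 2, 0, 0], ?_, fun v hv hne => ?_⟩
    · simp [waveMetric_apply]
      linarith
    · simp [waveMetric_apply] at hv ⊢
      have h1 : v 1 = (r + 1) / 2 * v 0 := by
        rw [hr] at hv ⊢
        linarith
      have hval : (-(p 2) ^ 2 - (p 3) ^ 2) * (v 0 * v 0) + v 0 * v 1 + v 1 * v 0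
          + v 2 * v 2 + v 3 * v 3 = v 0 ^ 2 + v 2 ^ 2 + v 3 ^ 2 := by
        rw [h1, hr]
        ring
      rw [hval]
      by_contra hle
      have h0 : v 0 = 0 := by nlinarith [sq_nonneg (v 0), sq_nonneg (v 2), sq_nonneg (v 3)]
      have h2 : v 2 = 0 := by nlinarith [sq_nonneg (v 0), sq_nonneg (v 2), sq_nonneg (v 3)]
      have h3 : v 3 = 0 := by nlinarith [sq_nonneg (v 0), sq_nonneg (v 2), sq_nonneg (v 3)]
      refine hne ?_
      ext i
      fin_cases i <;> simp [h0, h1, h2, h3]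

/-! ## The fields `Z`, `∇u` and the frame of the horizontal distribution -/

/-- The null field `-∂_u - y ∂_x + x ∂_y`. -/
def waveNull : VF := fun p => ![-1, 0, -p 3, p 2]

/-- The ∂_v component drops out because H = -(k² + h²). -/
theorem nullField_eq_waveNull :
    nullField (fun _ x y => -x ^ 2 - y ^ 2) (fun _ _ y => -y) (fun _ x _ => x) = waveNull := by
  ext p i
  fin_cases i <;> simp [nullField, waveNull, e]

theorem grad_uCoord : grad waveMetric uCoord = fun _ => e 1 := by
  have h : ∀ p, fderiv ℝ uCoord p = dc 0 := fun p =>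
    (ContinuousLinearMap.hasFDerivAt (dc 0) : HasFDerivAt (dc 0) (dc 0) p).fderiv
  ext p i
  rw [grad, sharp_waveMetric, h]
  fin_cases i <;> simp [dc, e]

theorem contDiff_waveNull {n : WithTop ℕ∞} : ContDiff ℝ n waveNull := by
  refine contDiff_pi.2 fun i => ?_
  fin_cases i <;> simp [waveNull] <;> fun_prop

theorem fderiv_waveNull (p a : R4) : fderiv ℝ waveNull p a = ![0, 0, -a 3, a 2] := by
  have hd : Differentiable ℝ waveNull := (contDiff_waveNull (n := 1)).differentiable one_ne_zero
  refine fderiv_apply_of_hasDerivAt (hd p) (hasDerivAt_pi.2 fun i => ?_)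
  have h2 := hasDerivAt_coord_line p a 2 0
  have h3 := hasDerivAt_coord_line p a 3 0
  fin_cases i
  · simpa [waveNull] using hasDerivAt_const (0 : ℝ) (-1 : ℝ)
  · simpa [waveNull] using hasDerivAt_const (0 : ℝ) (0 : ℝ)
  · exact h3.neg
  · exact h2

theorem isNull_waveNull : IsNull waveMetric waveNull := by
  refine fun p => ⟨fun h => ?_, ?_⟩
  · simpa [waveNull] using congrFun h 0
  · simp [waveMetric_apply, waveNull]
    ring

theorem waveMetric_waveNull_e (p : R4) : waveMetric p (waveNull p) (e 1) = -1 := by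
  simp [waveMetric_apply, waveNull, e]

theorem mem_horiz_iff (p a : R4) :
    a ∈ horiz waveMetric waveNull (fun _ => e 1) p ↔ a 0 = 0 ∧ a 1 = -p 3 * a 2 + p 2 * a 3 := by
  have hZ : waveMetric p (waveNull p) a =
      ((p 2) ^ 2 + (p 3) ^ 2) * a 0 - a 1 - p 3 * a 2 + p 2 * a 3 := by
    simp [waveMetric_apply, waveNull]
    ring
  have hN : waveMetric p (e 1) a = a 0 := by simp [waveMetric_apply, e]
  constructor
  · intro h
    have h1 := h (waveNull p) (Submodule.subset_span (by simp))
    have h2 := h (e 1) (Submodule.subset_span (by simp))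
    rw [hN] at h2
    rw [hZ, h2] at h1
    exact ⟨h2, by linarith⟩
  · rintro ⟨h0, h1⟩ w hw
    obtain ⟨s, t, rfl⟩ := Submodule.mem_span_pair.1 hw
    simp only [map_add, map_smul, add_apply, smul_apply,
      hZ, hN, h0, h1, smul_eq_mul]
    ring

/-- On ker du the ∂_v direction is degenerate, so only dx² + dy² survives. Full horizontality is not
needed, which lets this apply to values of ∇Z as well. -/
theorem waveMetric_horiz {p a b : R4} (ha : a 0 = 0) (hb : b 0 = 0) :
    waveMetric p a b = a 2 * b 2 + a 3 * b 3 := by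
  simp [waveMetric_apply, ha, hb]

/-! ## The almost complex structure -/

/-- The complex structure with `Z ↦ ∇u`, `X ↦ Y`. -/
def waveJ : EndField := fun p => LinearMap.toContinuousLinearMap
  { toFun := fun v =>
      -- `b` is -g(Z, v), the coefficient of ∂_v in the frame Z, ∂_v, X, Y.
      let b := v 1 + p 3 * v 2 - p 2 * v 3 - ((p 2) ^ 2 + (p 3) ^ 2) * v 0
      ![b, -v 0 + p 2 * v 2 + p 3 * v 3, p 3 * b - v 3 - p 2 * v 0, -(p 2) * b + v 2 - p 3 * v 0]
    map_add' := fun v w => by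
      ext i
      fin_cases i <;> simp <;> ring
    map_smul' := fun c v => by
      ext i
      fin_cases i <;> simp <;> ring }

theorem waveJ_apply (p v : R4) :
    waveJ p v = ![v 1 + p 3 * v 2 - p 2 * v 3 - ((p 2) ^ 2 + (p 3) ^ 2) * v 0,
      -v 0 + p 2 * v 2 + p 3 * v 3,
      p 3 * (v 1 + p 3 * v 2 - p 2 * v 3 - ((p 2) ^ 2 + (p 3) ^ 2) * v 0) - v 3 - p 2 * v 0,
      -(p 2) * (v 1 + p 3 * v 2 - p 2 * v 3 - ((p 2) ^ 2 + (p 3) ^ 2) * v 0) + v 2 - p 3 * v 0] :=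
  rfl

theorem waveJ_waveNull (p : R4) : waveJ p (waveNull p) = e 1 := by
  ext i
  fin_cases i <;> simp [waveJ_apply, waveNull, e_one, -mul_eq_zero] <;> ring

theorem waveJ_e (p : R4) : waveJ p (e 1) = -waveNull p := by
  ext i
  fin_cases i <;> simp [waveJ_apply, waveNull, e_one]

theorem waveJ_sq (p a : R4) : waveJ p (waveJ p a) = -a := by
  ext i
  fin_cases i <;> simp [waveJ_apply] <;> ring

theorem contDiff_waveJ {n : WithTop ℕ∞} : ContDiff ℝ n waveJ := by
  refine contDiff_clm_apply_iff.2 fun v => contDiff_pi.2 fun i => ?_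
  simp only [waveJ_apply]
  fin_cases i <;> simp <;> fun_prop

theorem waveJ_horiz {p a : R4} (ha : a ∈ horiz waveMetric waveNull (fun _ => e 1) p) :
    waveJ p a = ![0, p 2 * a 2 + p 3 * a 3, -a 3, a 2] := by
  obtain ⟨h0, h1⟩ := (mem_horiz_iff p a).1 ha
  have hb : a 1 + p 3 * a 2 - p 2 * a 3 - ((p 2) ^ 2 + (p 3) ^ 2) * a 0 = 0 := by
    rw [h0, h1]
    ring
  rw [waveJ_apply, hb, h0]
  ext i
  fin_cases i <;> simp

/-- The chosen orientation is opposite to the coordinate one, hence the negative sign of the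
determinant. -/
theorem isPositiveFrame_ppOrientation_iff (v : Fin 4 → R4) :
    IsPositiveFrame ppOrientation v ↔ (Matrix.of v).det < 0 := by
  rw [← Pi.basisFun_det_apply]
  constructor
  · rintro ⟨b, rfl, hb⟩
    have h := ((Pi.basisFun ℝ (Fin 4)).orientation_ne_iff_eq_neg b.orientation).2 hb
    have h' := mt ((Pi.basisFun ℝ (Fin 4)).orientation_eq_iff_det_pos b).2 h.symm
    exact lt_of_le_of_ne (not_lt.1 h') ((Pi.basisFun ℝ (Fin 4)).isUnit_det b).ne_zero
  · intro h
    obtain ⟨hli, hsp⟩ := ((Pi.basisFun ℝ (Fin 4)).is_basis_iff_det (v := v)).2 h.ne.isUnit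
    refine ⟨Module.Basis.mk hli hsp.ge, Module.Basis.coe_mk _ _, ?_⟩
    refine (Module.Basis.orientation_ne_iff_eq_neg _ _).1 fun heq => ?_
    have := ((Pi.basisFun ℝ (Fin 4)).orientation_eq_iff_det_pos _).1 heq.symm
    rw [Module.Basis.coe_mk] at this
    exact this.not_gt h

theorem det_frame (p a b : R4) (ha : a 0 = 0) (hb : b 0 = 0) :
    (Matrix.of ![waveNull p, e 1, a, b]).det = -(a 2 * b 3 - a 3 * b 2) := by
  simp [Matrix.det_succ_row_zero, Fin.sum_univ_succ, waveNull, e, ha, hb, Fin.succAbove]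
  ring

theorem sq_add_sq_pos_of_mem_horiz {p a : R4}
    (ha : a ∈ horiz waveMetric waveNull (fun _ => e 1) p) (hne : a ≠ 0) :
    0 < a 2 * a 2 + a 3 * a 3 := by
  obtain ⟨h0, h1⟩ := (mem_horiz_iff p a).1 ha
  by_contra hle
  have h2 : a 2 = 0 := by nlinarith [mul_self_nonneg (a 2), mul_self_nonneg (a 3)]
  have h3 : a 3 = 0 := by nlinarith [mul_self_nonneg (a 2), mul_self_nonneg (a 3)]
  refine hne ?_
  ext i
  fin_cases i <;> simp [h0, h1, h2, h3]

theorem isAdmissibleJAt_waveJ (p : R4) :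
    IsAdmissibleJAt waveMetric ppOrientation waveNull (fun _ => e 1) p (waveJ p) where
  map_fst := waveJ_waveNull p
  map_snd := waveJ_e p
  map_horiz a ha := by
    rw [waveJ_horiz ha, mem_horiz_iff]
    simp
    ring
  sq_horiz a _ := waveJ_sq p a
  isometry_horiz a ha b hb := by
    rw [waveMetric_horiz ((mem_horiz_iff p a).1 ha).1 ((mem_horiz_iff p b).1 hb).1,
      waveJ_horiz ha, waveJ_horiz hb, waveMetric_horiz (by simp) (by simp)]
    simp
    ring
  orient_horiz a ha hne := by
    rw [isPositiveFrame_ppOrientation_iff, waveJ_horiz ha,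
      det_frame p _ _ ((mem_horiz_iff p a).1 ha).1 (by simp)]
    have := sq_add_sq_pos_of_mem_horiz ha hne
    simp
    linarith

/-- An isometry of the plane H with square -1 sends X to a unit vector orthogonal to X, that is ±Y,
and the orientation selects Y. The values on Z, ∂_v, X, Y then determine `L`. -/
theorem IsAdmissibleJAt.eq_waveJ {p : R4} {L : R4 →L[ℝ] R4}
    (h : IsAdmissibleJAt waveMetric ppOrientation waveNull (fun _ => e 1) p L) : L = waveJ p := by
  have hX : (![0, -p 3, 1, 0] : R4) ∈ horiz waveMetric waveNull (fun _ => e 1) p := by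
    simp [mem_horiz_iff]
  have hY : (![0, p 2, 0, 1] : R4) ∈ horiz waveMetric waveNull (fun _ => e 1) p := by
    simp [mem_horiz_iff]
  set X : R4 := ![0, -p 3, 1, 0] with hXdef
  set Y : R4 := ![0, p 2, 0, 1] with hYdef
  have hX0 : X ≠ 0 := fun h => by simpa [hXdef] using congrFun h 2
  have hLX := h.map_horiz X hX
  obtain ⟨l0, l1⟩ := (mem_horiz_iff p _).1 hLX
  have hsymm := h.isometry_horiz X hX (L X) hLX
  have hnorm := h.isometry_horiz X hX X hX
  have hor := h.orient_horiz X hX hX0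
  rw [isPositiveFrame_ppOrientation_iff, det_frame p _ _ (by simp [hXdef]) l0] at hor
  rw [h.sq_horiz X hX, map_neg, waveMetric_horiz l0 (by simp [hXdef]),
    waveMetric_horiz (by simp [hXdef]) l0] at hsymm
  rw [waveMetric_horiz l0 l0, waveMetric_horiz (by simp [hXdef]) (by simp [hXdef])] at hnorm
  have e2 : X 2 = 1 := by simp [hXdef]
  have e3 : X 3 = 0 := by simp [hXdef]
  rw [e2, e3] at hsymm hnorm hor
  -- Isometry and square -1 give -g(LX, X) = g(X, LX), so LX is orthogonal to X.
  have c2 : L X 2 = 0 := by linarith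
  rw [c2] at hnorm hor
  -- Unit length leaves ±1; `hor` makes the sign positive.
  have c3 : L X 3 = 1 := by nlinarith
  have hLXY : L X = Y := by
    ext i
    fin_cases i <;> simp [hYdef, l0, l1, c2, c3]
  have hLY : L Y = -X := by rw [← hLXY, h.sq_horiz X hX]
  have hJX : waveJ p X = Y := by
    rw [waveJ_horiz hX]
    ext i
    fin_cases i <;> simp [hXdef, hYdef]
  have hJY : waveJ p Y = -X := by
    rw [waveJ_horiz hY]
    ext i
    fin_cases i <;> simp [hXdef, hYdef]
  ext1 v
  -- The expansion of `v` in the frame Z, ∂_v, X, Y.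
  have hv : v = (-v 0) • waveNull p
      + (v 1 + p 3 * v 2 - p 2 * v 3 - ((p 2) ^ 2 + (p 3) ^ 2) * v 0) • e 1
      + (v 2 - p 3 * v 0) • X + (v 3 + p 2 * v 0) • Y := by
    ext i
    fin_cases i <;> simp [hXdef, hYdef, waveNull, e_one] <;> ring
  rw [hv]
  simp only [map_add, map_smul, hLXY, hLY, hJX, hJY, waveJ_waveNull, waveJ_e]
  rw [h.map_fst, h.map_snd]

/-- Existence selects the branch of the definition, and uniqueness identifies the chosen witness. -/
theorem admissibleJ_eq_waveJ :
    admissibleJ waveMetric ppOrientation waveNull (fun _ => e 1) = waveJ := by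
  funext p
  have h : ∃ L, IsAdmissibleJAt waveMetric ppOrientation waveNull (fun _ => e 1) p L :=
    ⟨_, isAdmissibleJAt_waveJ p⟩
  rw [admissibleJ, dif_pos h]
  exact h.choose_spec.eq_waveJ

/-! ## The connection, brackets and shear -/

theorem christoffel_waveMetric (p v w : R4) :
    christoffel waveMetric p v w =
      ![0, -(p 2 * v 2 + p 3 * v 3) * w 0 - (p 2 * w 2 + p 3 * w 3) * v 0,
        p 2 * (v 0 * w 0), p 3 * (v 0 * w 0)] := by
  rw [christoffel, sharp_waveMetric]
  simp only [fderiv_waveMetric]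
  ext i
  fin_cases i <;> simp [e] <;> ring

theorem nabla_waveNull (p v : R4) :
    nabla waveMetric waveNull p v =
      ![0, p 2 * v 2 + p 3 * v 3, -v 3 - p 2 * v 0, v 2 - p 3 * v 0] := by
  have h : p 2 * waveNull p 2 + p 3 * waveNull p 3 = 0 := by
    simp [waveNull]
    ring
  rw [nabla, christoffel_waveMetric, fderiv_waveNull, h]
  ext i
  fin_cases i <;> simp [waveNull] <;> ring

theorem nabla_e_one (p v : R4) : nabla waveMetric (fun _ => e 1) p v = 0 := by
  rw [nabla, christoffel_waveMetric, fderiv_const_apply]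
  ext i
  fin_cases i <;> simp [e]

theorem gram2_waveMetric_inv (p : R4) :
    (gram2 waveMetric waveNull (fun _ => e 1) p)⁻¹ = !![0, -1; -1, 0] := by
  refine Matrix.inv_eq_right_inv ?_
  rw [gram2, (isNull_waveNull p).2, isLorentzian_waveMetric.symm p (e 1), waveMetric_waveNull_e]
  ext i j
  fin_cases i <;> fin_cases j <;> simp [waveMetric_apply, e]

/-- The result is ξ(v) X + η(v) Y, with ξ = dx - y du and η = dy + x du. -/
theorem proj_waveMetric (p v : R4) :
    proj waveMetric waveNull (fun _ => e 1) p v =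
      ![0, -p 3 * (v 2 - p 3 * v 0) + p 2 * (v 3 + p 2 * v 0), v 2 - p 3 * v 0,
        v 3 + p 2 * v 0] := by
  rw [proj, vertCoeff, gram2_waveMetric_inv]
  ext i
  fin_cases i <;>
    simp [waveMetric_apply, waveNull, e_one, Matrix.mulVec, dotProduct] <;> ring

theorem expansion_waveNull (p : R4) :
    expansion waveMetric waveNull (fun _ => e 1) waveNull p = 0 := by
  simp only [expansion, nabla_waveNull, proj_waveMetric]
  simp [Matrix.trace, Fin.sum_univ_four, e]

theorem expansion_e_one (p : R4) :
    expansion waveMetric waveNull (fun _ => e 1) (fun _ => e 1) p = 0 := by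
  simp [expansion, nabla_e_one, proj_waveMetric, Matrix.trace, Fin.sum_univ_four]

/-- On H the endomorphism π ∘ ∇Z is the quarter turn (a₂, a₃) ↦ (-a₃, a₂): it is skew, so its trace
and its symmetric part both vanish. -/
theorem shear_waveNull (p a : R4) :
    shear waveMetric waveNull (fun _ => e 1) waveNull p a = 0 := by
  rw [shear, expansion_waveNull, ← sharp_waveMetric_zero p]
  congr 1
  funext b
  rw [waveMetric_horiz (by simp [nabla_waveNull]) (by simp [proj_waveMetric]),
    waveMetric_horiz (by simp [nabla_waveNull]) (by simp [proj_waveMetric])]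
  simp [nabla_waveNull, proj_waveMetric]
  ring

theorem shear_e_one (p a : R4) :
    shear waveMetric waveNull (fun _ => e 1) (fun _ => e 1) p a = 0 := by
  rw [shear, expansion_e_one, ← sharp_waveMetric_zero p]
  simp [nabla_e_one]

/-- The derivative of the equations that say that `W` is horizontal. -/
theorem fderiv_horiz {W : VF} (hW : ContDiff ℝ ∞ W)
    (hH : ∀ p, W p ∈ horiz waveMetric waveNull (fun _ => e 1) p) (p v : R4) :
    fderiv ℝ W p v 0 = 0 ∧ fderiv ℝ W p v 1 =
      -v 3 * W p 2 - p 3 * fderiv ℝ W p v 2 + v 2 * W p 3 + p 2 * fderiv ℝ W p v 3 := by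
  have hd : DifferentiableAt ℝ W p := (hW.differentiable (by simp)) p
  have h0 : (fun q => W q 0) = fun _ => 0 := funext fun q => ((mem_horiz_iff q _).1 (hH q)).1
  have h1 : (fun q => W q 1) = fun q => -q 3 * W q 2 + q 2 * W q 3 :=
    funext fun q => ((mem_horiz_iff q _).1 (hH q)).2
  rw [fderiv_pi_apply hd 0, fderiv_pi_apply hd 1, h0, h1, fderiv_pi_apply hd 2,
    fderiv_pi_apply hd 3]
  have hc : ∀ i, HasFDerivAt (fun q : R4 => q i) (dc i) p := fun i => (dc i).hasFDerivAt
  have hw : ∀ i, HasFDerivAt (fun q => W q i) (fderiv ℝ (fun q => W q i) p) p := fun i =>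
    (differentiableAt_pi.1 hd i).hasFDerivAt
  refine ⟨by simp, ?_⟩
  have h := (((hc 3).neg.mul (hw 2)).add ((hc 2).mul (hw 3))).fderiv
  refine (congrArg (· v) h).trans ?_
  simp [dc]
  ring

/-- Differentiating W₁ = -y W₂ + x W₃ along Z produces the extra terms -x W₂ - y W₃, and these are
exactly what subtracting DZ(W) = (0, 0, -W₃, W₂) contributes. -/
theorem lieBracket_waveNull_mem_horiz {W : VF} (hW : ContDiff ℝ ∞ W)
    (hH : ∀ p, W p ∈ horiz waveMetric waveNull (fun _ => e 1) p) (p : R4) :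
    VectorField.lieBracket ℝ waveNull W p ∈ horiz waveMetric waveNull (fun _ => e 1) p := by
  obtain ⟨h0, h1⟩ := fderiv_horiz hW hH p (waveNull p)
  rw [mem_horiz_iff, VectorField.lieBracket_eq]
  simp only [fderiv_waveNull, Pi.sub_apply, h0, h1]
  simp [waveNull]
  ring

theorem lieBracket_e_one_mem_horiz {W : VF} (hW : ContDiff ℝ ∞ W)
    (hH : ∀ p, W p ∈ horiz waveMetric waveNull (fun _ => e 1) p) (p : R4) :
    VectorField.lieBracket ℝ (fun _ => e 1) W p ∈ horiz waveMetric waveNull (fun _ => e 1) p := by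
  obtain ⟨h0, h1⟩ := fderiv_horiz hW hH p (e 1)
  rw [mem_horiz_iff, VectorField.lieBracket_eq]
  simp only [fderiv_const_apply, Pi.sub_apply, h0, h1]
  simp [e]

/-! ### Admissibility of the plane wave -/

theorem linearIndependent_waveNull (p : R4) : LinearIndependent ℝ ![waveNull p, e 1] := by
  refine LinearIndependent.pair_iff.2 fun s t h => ?_
  have h0 := congrFun h 0
  have h1 := congrFun h 1
  simp [waveNull, e] at h0 h1
  exact ⟨h0, h1⟩

theorem grad_const (c : ℝ) (p : R4) : grad waveMetric (fun _ => c) p = 0 := by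
  rw [grad, fderiv_const_apply]
  exact sharp_waveMetric_zero p

theorem isAdmissible_waveMetric :
    IsAdmissible waveMetric ppOrientation waveNull (fun _ => e 1) where
  complex :=
    { semiRiemannian := isLorentzian_waveMetric.toIsSemiRiemannian
      smooth_fst := contDiff_waveNull
      smooth_snd := contDiff_const
      linearIndependent := linearIndependent_waveNull
      spacelike := fun p a ha hne => by
        have h0 := ((mem_horiz_iff p a).1 ha).1
        rw [waveMetric_horiz h0 h0]
        exact sq_add_sq_pos_of_mem_horiz ha hne
      isAdmissibleJAt := fun p => by
        rw [admissibleJ_eq_waveJ]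
        exact isAdmissibleJAt_waveJ p
      bracket_fst := fun _ hW hH p => lieBracket_waveNull_mem_horiz hW hH p
      bracket_snd := fun _ hW hH p => lieBracket_e_one_mem_horiz hW hH p
      shear_comm := fun p a _ => by
        simp only [admissibleJ_eq_waveJ, waveJ_waveNull, shear_waveNull, shear_e_one, map_zero] }
  exists_grad := ⟨uCoord, fun _ => 1, contDiff_coord 0, contDiff_const, fun p => by
    rw [grad_uCoord, one_smul]⟩
  grad_fst_snd p := by
    simp only [waveMetric_waveNull_e, grad_const, Submodule.zero_mem]
  grad_fst_fst p := by
    simp only [(isNull_waveNull _).2, grad_const, Submodule.zero_mem]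

/-! ## Integrability -/

theorem fderiv_waveJ (p v w : R4) :
    fderiv ℝ waveJ p v w =
      ![v 3 * w 2 - v 2 * w 3 - 2 * (p 2 * v 2 + p 3 * v 3) * w 0,
        v 2 * w 2 + v 3 * w 3,
        v 3 * (w 1 + p 3 * w 2 - p 2 * w 3 - ((p 2) ^ 2 + (p 3) ^ 2) * w 0)
          + p 3 * (v 3 * w 2 - v 2 * w 3 - 2 * (p 2 * v 2 + p 3 * v 3) * w 0) - v 2 * w 0,
        -v 2 * (w 1 + p 3 * w 2 - p 2 * w 3 - ((p 2) ^ 2 + (p 3) ^ 2) * w 0)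
          - p 2 * (v 3 * w 2 - v 2 * w 3 - 2 * (p 2 * v 2 + p 3 * v 3) * w 0) - v 3 * w 0] := by
  have hd : Differentiable ℝ waveJ := (contDiff_waveJ (n := 1)).differentiable one_ne_zero
  rw [← fderiv_apply_const (hd p)]
  refine fderiv_apply_of_hasDerivAt ((hd p).clm_apply (differentiableAt_const w))
    (hasDerivAt_pi.2 fun i => ?_)
  have h2 := hasDerivAt_coord_line p v 2 0
  have h3 := hasDerivAt_coord_line p v 3 0
  -- The derivative of -g(Z, w), a factor shared by three of the four components.
  have hb := (((h3.mul_const (w 2)).const_add (w 1)).sub (h2.mul_const (w 3))).sub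
    (((h2.pow 2).add (h3.pow 2)).mul_const (w 0))
  fin_cases i
  · refine HasDerivAt.congr_deriv (hb) ?_
    simp [-mul_eq_mul_right_iff, -mul_eq_mul_left_iff]
    ring
  · exact ((h2.mul_const (w 2)).const_add (-w 0)).add (h3.mul_const (w 3))
  · refine HasDerivAt.congr_deriv (((h3.mul hb).sub_const (w 3)).sub (h2.mul_const (w 0))) ?_
    simp [-mul_eq_mul_right_iff, -mul_eq_mul_left_iff]
    ring
  · refine HasDerivAt.congr_deriv (((h2.neg.mul hb).add_const (w 2)).sub (h3.mul_const (w 0))) ?_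
    simp [-mul_eq_mul_right_iff, -mul_eq_mul_left_iff]
    ring

/-- By the product rule and J² = -1, all derivatives of `A` and `B` cancel. What remains is
tensorial, (∂_{JA}J)B - (∂_{JB}J)A + J(∂_B J)A - J(∂_A J)B, and vanishes by a polynomial identity.
-/
theorem nijenhuis_waveJ {A B : VF} (hA : Differentiable ℝ A) (hB : Differentiable ℝ B) (p : R4) :
    nijenhuis waveJ A B p = 0 := by
  have hd : Differentiable ℝ waveJ := (contDiff_waveJ (n := 1)).differentiable one_ne_zero
  have hJ : ∀ {C : VF}, Differentiable ℝ C → ∀ v,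
      fderiv ℝ (fun q => waveJ q (C q)) p v =
        fderiv ℝ waveJ p v (C p) + waveJ p (fderiv ℝ C p v) := by
    intro C hC v
    rw [fderiv_clm_apply (hd p) (hC p)]
    simp [add_comm]
  have htensor : fderiv ℝ waveJ p (waveJ p (A p)) (B p) - fderiv ℝ waveJ p (waveJ p (B p)) (A p)
      + waveJ p (fderiv ℝ waveJ p (B p) (A p)) - waveJ p (fderiv ℝ waveJ p (A p) (B p)) = 0 := by
    simp only [fderiv_waveJ, waveJ_apply]
    ext i
    fin_cases i <;> simp <;> ring
  rw [nijenhuis, VectorField.lieBracket_eq, VectorField.lieBracket_eq, VectorField.lieBracket_eq,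
    VectorField.lieBracket_eq]
  simp only [hJ hA, hJ hB, map_sub, map_add, waveJ_sq]
  rw [← htensor]
  abel

/-! ## The Kähler form -/

/-- The `1`-form `e^u Z^♭`. -/
def waveForm (p : R4) : R4 →L[ℝ] ℝ := Real.exp (p 0) • waveMetric p (waveNull p)

theorem waveForm_apply (p b : R4) :
    waveForm p b = Real.exp (p 0) *
      (((p 2) ^ 2 + (p 3) ^ 2) * b 0 - b 1 - p 3 * b 2 + p 2 * b 3) := by
  simp [waveForm, waveMetric_apply, waveNull]
  ring

theorem contDiff_waveForm {n : WithTop ℕ∞} : ContDiff ℝ n waveForm := by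
  refine contDiff_clm_apply_iff.2 fun b => ?_
  simp only [waveForm_apply]
  fun_prop

theorem fderiv_waveForm (p a b : R4) :
    fderiv ℝ waveForm p a b = Real.exp (p 0) *
      (a 0 * (((p 2) ^ 2 + (p 3) ^ 2) * b 0 - b 1 - p 3 * b 2 + p 2 * b 3)
        + 2 * (p 2 * a 2 + p 3 * a 3) * b 0 - a 3 * b 2 + a 2 * b 3) := by
  have hd : Differentiable ℝ waveForm := (contDiff_waveForm (n := 1)).differentiable one_ne_zero
  rw [← fderiv_apply_const (hd p)]
  refine fderiv_apply_of_hasDerivAt ((hd p).clm_apply (differentiableAt_const b)) ?_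
  simp only [waveForm_apply]
  have h0 := hasDerivAt_coord_line p a 0 0
  have h2 := hasDerivAt_coord_line p a 2 0
  have h3 := hasDerivAt_coord_line p a 3 0
  refine HasDerivAt.congr_deriv
    (h0.exp.mul ((((((h2.pow 2).add (h3.pow 2)).mul_const (b 0)).sub_const (b 1)).sub
      (h3.mul_const (b 2))).add (h2.mul_const (b 3)))) ?_
  simp
  ring

/-- Writing the 1-form through a linear isometry lets smoothness of the covector field e^u Z^♭ carry
over to alternating forms. -/
theorem dFlat_eq_extDeriv :
    dFlat waveMetric waveNull Real.exp uCoord =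
      extDeriv fun p => ContinuousAlternatingMap.ofSubsingletonLIE (𝕜 := ℝ) (E := R4) (F := ℝ)
        (ι := Fin 1) 0 (waveForm p) := by
  unfold dFlat
  congr 1

theorem contDiff_ofSubsingleton_waveForm {n : WithTop ℕ∞} :
    ContDiff ℝ n fun p => ContinuousAlternatingMap.ofSubsingletonLIE (𝕜 := ℝ) (E := R4) (F := ℝ)
      (ι := Fin 1) 0 (waveForm p) :=
  (LinearIsometryEquiv.contDiff _).comp contDiff_waveForm

theorem extDeriv_dFlat (p : R4) :
    extDeriv (dFlat waveMetric waveNull Real.exp uCoord) p = 0 := by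
  rw [dFlat_eq_extDeriv, extDeriv_extDeriv (r := 2) contDiff_ofSubsingleton_waveForm (by simp)]
  rfl

theorem contDiff_dFlat : ContDiff ℝ ∞ (dFlat waveMetric waveNull Real.exp uCoord) := by
  rw [dFlat_eq_extDeriv]
  exact (ContinuousAlternatingMap.alternatizeUncurryFinCLM ℝ R4 ℝ).contDiff.comp
    ((contDiff_ofSubsingleton_waveForm (n := ∞)).fderiv_right (m := ∞) (by simp))

/-- This is dω(a, b) = (D_a ω)(b) - (D_b ω)(a) for ω = e^u Z^♭. -/
theorem dFlat_apply (p a b : R4) :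
    dFlat waveMetric waveNull Real.exp uCoord p ![a, b] =
      Real.exp (p 0) * (a 1 * b 0 - a 0 * b 1
        - (p 3 + 2 * p 2) * (a 0 * b 2 - a 2 * b 0) + (p 2 - 2 * p 3) * (a 0 * b 3 - a 3 * b 0)
        + 2 * (a 2 * b 3 - a 3 * b 2)) := by
  have key : dFlat waveMetric waveNull Real.exp uCoord p ![a, b] =
      fderiv ℝ waveForm p a b - fderiv ℝ waveForm p b a := by
    have hd : Differentiable ℝ waveForm := (contDiff_waveForm (n := 1)).differentiable one_ne_zero
    rw [dFlat_eq_extDeriv, extDeriv_apply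
      ((contDiff_ofSubsingleton_waveForm (n := 1)).differentiable one_ne_zero p)]
    refine (Fin.sum_univ_two _).trans ?_
    change (-1) ^ 0 • fderiv ℝ (fun q => waveForm q b) p a
      + (-1) ^ 1 • fderiv ℝ (fun q => waveForm q a) p b = _
    rw [fderiv_apply_const (hd p), fderiv_apply_const (hd p)]
    simp [sub_eq_add_neg]
  rw [key, fderiv_waveForm, fderiv_waveForm]
  ring

/-- In the coframe this is e^u (α² + β² + 2ξ² + 2η²), a diagonal form from which symmetry and
positivity can be read off. -/
theorem dFlat_waveJ (p a b : R4) :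
    dFlat waveMetric waveNull Real.exp uCoord p ![a, waveJ p b] =
      Real.exp (p 0) * (a 0 * b 0
        + (a 1 + p 3 * a 2 - p 2 * a 3 - ((p 2) ^ 2 + (p 3) ^ 2) * a 0)
          * (b 1 + p 3 * b 2 - p 2 * b 3 - ((p 2) ^ 2 + (p 3) ^ 2) * b 0)
        + 2 * ((a 2 - p 3 * a 0) * (b 2 - p 3 * b 0) + (a 3 + p 2 * a 0) * (b 3 + p 2 * b 0))) := by
  rw [dFlat_apply, waveJ_apply]
  simp
  ring

theorem isKahler_inducedTensor :
    IsKahler waveJ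
      (inducedTensor waveMetric ppOrientation waveNull (fun _ => e 1) Real.exp uCoord) where
  smooth_J := contDiff_waveJ
  sq_J := waveJ_sq
  integrable A B hA hB p :=
    nijenhuis_waveJ (hA.differentiable (by simp)) (hB.differentiable (by simp)) p
  smooth := by
    refine contDiff_clm_apply_iff.2 fun a => contDiff_clm_apply_iff.2 fun b => ?_
    simp only [inducedTensor_apply, admissibleJ_eq_waveJ, dFlat_waveJ]
    fun_prop
  symm p a b := by
    simp only [inducedTensor_apply, admissibleJ_eq_waveJ, dFlat_waveJ]
    ring
  pos p a hne := by
    rw [inducedTensor_apply, admissibleJ_eq_waveJ, dFlat_waveJ]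
    refine mul_pos (Real.exp_pos _) ?_
    by_contra hle
    -- With `a 0`, the values `s`, `t`, `r` are the frame coefficients of `a` up to sign, so they
    -- vanish together only at `a = 0`.
    set s := a 1 + p 3 * a 2 - p 2 * a 3 - ((p 2) ^ 2 + (p 3) ^ 2) * a 0 with hs
    set t := a 2 - p 3 * a 0 with ht
    set r := a 3 + p 2 * a 0 with hr
    have n0 := mul_self_nonneg (a 0)
    have n1 := mul_self_nonneg s
    have n2 := mul_self_nonneg t
    have n3 := mul_self_nonneg r
    have h0 : a 0 = 0 := mul_self_eq_zero.1 (by linarith)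
    have h1 : s = 0 := mul_self_eq_zero.1 (by linarith)
    have h2 : a 2 = 0 := by
      have : t = 0 := mul_self_eq_zero.1 (by linarith)
      simpa [ht, h0] using this
    have h3 : a 3 = 0 := by
      have : r = 0 := mul_self_eq_zero.1 (by linarith)
      simpa [hr, h0] using this
    simp [hs, h0, h2, h3] at h1
    refine hne ?_
    ext i
    fin_cases i <;> simp [h0, h1, h2, h3]
  hermitian p a b := by
    simp only [inducedTensor_apply, admissibleJ_eq_waveJ, dFlat_waveJ]
    simp only [waveJ_apply]
    simp
    ring
  closed := by
    -- The Kähler form is d(e^u Z^♭), because that 2-form is J-invariant; it is closed since d² = 0.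
    refine ⟨_, contDiff_dFlat, fun p a b => ?_, extDeriv_dFlat⟩
    rw [inducedTensor_apply, admissibleJ_eq_waveJ, dFlat_waveJ, dFlat_apply, waveJ_apply]
    simp
    ring

theorem waveJ_xField (p : R4) :
    waveJ p (xField (fun _ _ y => -y) p) = yField (fun _ x _ => x) p := by
  ext i
  fin_cases i <;> simp [waveJ_apply, xField, yField, e]

end PlaneWave

end

/-! ### Reduction of the theorem to the explicit fields -/

theorem mainTheorem12 (H k h : ℝ → ℝ → ℝ → ℝ)
    (hH : ∀ u x y, H u x y = -x ^ 2 - y ^ 2)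
    (hk : ∀ u x y, k u x y = -y)
    (hh : ∀ u x y, h u x y = x)
    (g : PlaneWave.BilinField) (hg : g = PlaneWave.ppWave H)
    (Z N : PlaneWave.VF) (hZ : Z = PlaneWave.nullField H k h)
    (hN : N = PlaneWave.grad g PlaneWave.uCoord) :
    PlaneWave.IsLorentzian g ∧
    PlaneWave.IsNull g Z ∧
    PlaneWave.IsAdmissible g PlaneWave.ppOrientation Z N ∧
    (∀ p, PlaneWave.admissibleJ g PlaneWave.ppOrientation Z N p (PlaneWave.xField k p) =
        PlaneWave.yField h p) ∧
    PlaneWave.IsKahler (PlaneWave.admissibleJ g PlaneWave.ppOrientation Z N)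
      (PlaneWave.inducedTensor g PlaneWave.ppOrientation Z N Real.exp PlaneWave.uCoord) := by

  obtain rfl : H = fun _ x y => -x ^ 2 - y ^ 2 := by
    funext u x y
    exact hH u x y
  obtain rfl : k = fun _ _ y => -y := by
    funext u x y
    exact hk u x y
  obtain rfl : h = fun _ x _ => x := by
    funext u x y
    exact hh u x y
  change g = PlaneWave.waveMetric at hg
  subst hg
  rw [PlaneWave.nullField_eq_waveNull] at hZ
  rw [PlaneWave.grad_uCoord] at hN
  subst hZ hN
  rw [PlaneWave.admissibleJ_eq_waveJ]
  exact ⟨PlaneWave.isLorentzian_waveMetric, PlaneWave.isNull_waveNull,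
    PlaneWave.isAdmissible_waveMetric, PlaneWave.waveJ_xField, PlaneWave.isKahler_inducedTensor⟩
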